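/- There is a constant $d$ such that for all $n,m\ge 0$ and every function $f:\{0,1\}^n\to\{0,1\}^m$ (in particular, for $m=1$, every Boolean function on $n$ inputs) there is a measurement-based quantum computation (MBQC) pattern of depth at most $d$ that implements exactly the quantum oracle $$U_f:\ |x\rangle|y\rangle\longmapsto|x\rangle|y\oplus f(x)\rangle,\qquad x\in\{0,1\}^n,\ y\in\{0,1\}^m .$$ Here a pattern (in standard form) consists of a finite set of qubits, with $n+m$ distinct input qubits and $n+m$ distinct output qubits, labelled by the positions in the registers $x,y$ (a qubit may be both an input and an output); a simple graph on the set of qubits; an angle $\alpha_u\in\mathbb R$ for every non-output qubit $u$; and, for every qubit $v$, two sets $S_v,T_v$ of non-output qubits. The dependency graph has an arrow from $u$ to $v$ whenever $u\in S_v\cup T_v$; it must have no directed cycle. The pattern is executed as follows. The input state is placed on the input qubits and every other qubit is prepared in $|+\rangle=(|0\rangle+|1\rangle)/\sqrt2$; a controlled-$Z$ is applied along each edge of the graph; each non-output qubit $u$ is measured in the basis $(|0\rangle\pm e^{i\theta_u}|1\rangle)/\sqrt2$ with $\theta_u=(-1)^{s_u}\alpha_u+t_u\pi$, giving an outcome in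 $\{0,1\}$ ($0$ for $+$, $1$ for $-$); finally $X^{s_v}Z^{t_v}$ is applied to each output qubit $v$. For each qubit $v$, $s_v$ and $t_v$ denote the sums modulo $2$ of the outcomes of the measurements of the qubits in $S_v$ and in $T_v$. The depth of the pattern is the number of qubits on a longest directed path in its dependency graph (sums modulo $2$ of classical bits are free). If $A_s$ is the linear operator from the input to the output space that corresponds to the combined outcome $s$, the pattern implements $U$ exactly if $\sum_s A_s\rho A_s^\dagger=U\rho U^\dagger$ for every operator $\rho$ on the input space. -/

import Mathlib

open scoped Matrix

noncomputable section

namespace MBQC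

/-- Classical assignments of bits to a register of qubits labelled by `ι`; they label the
computational basis of the Hilbert space of that register. -/
abbrev Bits (ι : Type) : Type := ι → Bool

/-- The `n`-qubit tensor product `⨂ᵢ A i` of one-qubit operators, in the computational basis. -/
def tensor {ι : Type} [Fintype ι] (A : ι → Matrix Bool Bool ℂ) :
    Matrix (Bits ι) (Bits ι) ℂ :=
  Matrix.of fun z w => ∏ i, A i (z i) (w i)

/-- The Pauli operator `X`, i.e. `|b⟩ ↦ |b ⊕ 1⟩`. -/
def pauliX : Matrix Bool Bool ℂ := Matrix.of fun a b => if a = !b then 1 else 0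

/-- The Pauli operator `Z`, i.e. `|b⟩ ↦ (-1)^b |b⟩`. -/
def pauliZ : Matrix Bool Bool ℂ := Matrix.diagonal fun b => if b then -1 else 1

/-- The coefficient at `|b⟩` of the state `|+⟩ = (|0⟩ + |1⟩)/√2`. -/
def ketPlus (_b : Bool) : ℂ := 1 / (Real.sqrt 2 : ℂ)

/-- The coefficient at `⟨b|` of the bra `(⟨0| + (-1)^s e^{-iθ} ⟨1|)/√2`: it is `⟨+_θ|` for the
outcome `s = 0` and `⟨-_θ|` for the outcome `s = 1` of a measurement in the basis
`|±_θ⟩ = (|0⟩ ± e^{iθ} |1⟩)/√2`. -/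
def braMeas (θ : ℝ) (s : Bool) (b : Bool) : ℂ :=
  (1 / (Real.sqrt 2 : ℂ)) *
    (if b then (if s then -1 else 1) * Complex.exp (-(Complex.I * (θ : ℂ))) else 1)

/-- The sum modulo 2 of the measurement outcomes in `S`. -/
def parity {M : Type} (S : Finset M) (s : Bits M) : Bool :=
  decide (Odd (S.filter fun u => s u = true).card)

/-- A measurement pattern in standard form, with input qubits labelled by `I` and output qubits
labelled by `O`. Its qubits are the measured ones, `M`, and the output ones, `O`; an input qubit
may be of either kind. All non-input qubits are prepared in `|+⟩`, then controlled-`Z` is applied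
along every edge of the entanglement graph, then every qubit `u` of `M` is measured in the basis
`|±_θ⟩` with `θ = (-1)^s · angle u + t · π`, and finally `X^s Z^t` is applied to every output
qubit. In each case, the signals `s` and `t` of a qubit `v` are the sums modulo 2 of the outcomes
in `xSignal v` and `zSignal v`. The dependencies have no cycle. -/
structure Pattern (I O : Type) where
  M : Type
  [fintypeM : Fintype M]
  [decEqM : DecidableEq M]
  graph : SimpleGraph (M ⊕ O)
  [decAdj : DecidableRel graph.Adj]
  input : I ↪ M ⊕ O
  angle : M → ℝ
  xSignal : M ⊕ O → Finset M
  zSignal : M ⊕ O → Finset M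
  acyclic : ∀ v : M ⊕ O, ¬ Relation.TransGen
    (fun a b : M ⊕ O => ∃ u : M, a = Sum.inl u ∧ (u ∈ xSignal b ∨ u ∈ zSignal b)) v v

namespace Pattern

attribute [instance] Pattern.fintypeM Pattern.decEqM Pattern.decAdj

variable {I O : Type} (P : Pattern I O)

/-- All the qubits of the pattern. -/
abbrev Qubit : Type := P.M ⊕ O

/-- The dependency graph: there is an arrow from `a` to `b` if the measurement of `b`, or the
correction of `b`, uses the outcome of the measurement of `a`. -/
def Dep (a b : P.Qubit) : Prop :=
  ∃ u : P.M, a = Sum.inl u ∧ (u ∈ P.xSignal b ∨ u ∈ P.zSignal b)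

/-- The depth: the number of qubits on a longest path in the dependency graph. -/
def depth : ℕ∞ :=
  ⨆ (l : List P.Qubit) (_ : l.IsChain P.Dep), (l.length : ℕ∞)

section Semantics

variable [Fintype I] [DecidableEq I] [Fintype O] [DecidableEq O]

/-- Preparation: the inputs are placed on the input qubits, all others are set to `|+⟩`. -/
def prepare : Matrix (Bits P.Qubit) (Bits I) ℂ :=
  Matrix.of fun z x =>
    if (fun i => z (P.input i)) = x then
      ∏ v ∈ Finset.univ.filter (fun v => ∀ i, P.input i ≠ v), ketPlus (z v)
    else 0

/-- Entanglement: controlled-`Z` along every edge of the graph. -/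
def entangle : Matrix (Bits P.Qubit) (Bits P.Qubit) ℂ :=
  Matrix.diagonal fun z => ∏ e ∈ P.graph.edgeFinset, if ∀ v ∈ e, z v = true then -1 else 1

/-- The angle by which the qubit `u` is measured, given the outcomes `s`. -/
def actualAngle (s : Bits P.M) (u : P.M) : ℝ :=
  (if parity (P.xSignal (Sum.inl u)) s then -P.angle u else P.angle u) +
    (if parity (P.zSignal (Sum.inl u)) s then Real.pi else 0)

/-- Measurement of all the qubits in `M`, in the branch where the outcomes are `s`. -/
def measure (s : Bits P.M) : Matrix (Bits O) (Bits P.Qubit) ℂ :=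
  Matrix.of fun y z =>
    if (fun o => z (Sum.inr o)) = y then
      ∏ u : P.M, braMeas (P.actualAngle s u) (s u) (z (Sum.inl u))
    else 0

/-- The corrections on the output qubits, in the branch where the outcomes are `s`. -/
def correct (s : Bits P.M) : Matrix (Bits O) (Bits O) ℂ :=
  tensor fun o =>
    (if parity (P.xSignal (Sum.inr o)) s then pauliX else 1) *
      (if parity (P.zSignal (Sum.inr o)) s then pauliZ else 1)

/-- The (unnormalised) operator that the pattern performs if the outcomes are `s`. -/
def branch (s : Bits P.M) : Matrix (Bits O) (Bits I) ℂ :=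
  P.correct s * P.measure s * P.entangle * P.prepare

/-- The quantum operation performed by the pattern: the sum over all branches. -/
def channel (ρ : Matrix (Bits I) (Bits I) ℂ) : Matrix (Bits O) (Bits O) ℂ :=
  ∑ s : Bits P.M, P.branch s * ρ * (P.branch s)ᴴ

/-- The pattern performs exactly the operation `ρ ↦ U ρ U†`. -/
def Implements (U : Matrix (Bits O) (Bits I) ℂ) : Prop :=
  ∀ ρ : Matrix (Bits I) (Bits I) ℂ, P.channel ρ = U * ρ * Uᴴ

end Semantics

end Pattern

/-- The map `(x, y) ↦ (x, y ⊕ f(x))`, on `n + m` bits. -/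
def oracleMap {n m : ℕ} (f : Bits (Fin n) → Bits (Fin m)) (w : Bits (Fin n ⊕ Fin m)) :
    Bits (Fin n ⊕ Fin m) :=
  Sum.elim (fun i => w (Sum.inl i))
    (fun j => xor (w (Sum.inr j)) (f (fun i => w (Sum.inl i)) j))

/-- The quantum oracle `|x⟩|y⟩ ↦ |x⟩|y ⊕ f(x)⟩`. -/
def oracle {n m : ℕ} (f : Bits (Fin n) → Bits (Fin m)) :
    Matrix (Bits (Fin n ⊕ Fin m)) (Bits (Fin n ⊕ Fin m)) ℂ :=
  Matrix.of fun z w => if z = oracleMap f w then 1 else 0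

end MBQC

end

/-! The oracle is the diagonal unitary `|x, w⟩ ↦ (-1)^(w·f(x)) |x, w⟩`, conjugated by Hadamard gates
on the second register. The phase of this unitary is a real function on bit strings, hence a
combination of Walsh characters `(-1)^(a·z)`, and for each character a gadget of two qubits performs
`exp(i c (-1)^(a·z))`: an axle joined to the qubits of `a` and measured with angle `0`, and a leaf
joined to the axle and measured with angle `±2c`. The Hadamard gates are measurements with angle
`0` as well. The gadgets commute with each other, and their byproducts are powers of `Z`; the
byproducts of the first Hadamard gates are powers of `X`, which only change the sign of the angle
of a gadget. So the angles of all leaves depend only on outcomes of measurements with the fixed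
angle `0`, and three time steps suffice: angle `0`, leaves, corrections. -/

noncomputable section

open scoped symmDiff

namespace MBQC

section Walsh

variable {R : Type*} [CommRing R]

/-- The sign `(-1)^b`, in an arbitrary ring since it occurs both in amplitudes and in angles. -/
def bitSign (b : Bool) : R := if b then -1 else 1

@[simp] theorem bitSign_false : bitSign false = (1 : R) := rfl

@[simp] theorem bitSign_true : bitSign true = (-1 : R) := rfl

@[simp, norm_cast] theorem ofReal_bitSign (b : Bool) :
    ((bitSign b : ℝ) : ℂ) = bitSign b := by
  cases b <;> simp

theorem norm_bitSign (b : Bool) : ‖(bitSign b : ℂ)‖ = 1 := by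
  cases b <;> simp

theorem bitSign_injective : Function.Injective (bitSign : Bool → ℝ) := by
  intro a b h
  cases a <;> cases b <;> first | rfl | norm_num at h

theorem bitSign_xor (a b : Bool) : (bitSign (xor a b) : R) = bitSign a * bitSign b := by
  cases a <;> cases b <;> simp

theorem ite_bitSign (a b : Bool) : (if a then bitSign b else 1 : R) = bitSign (a && b) := by
  cases a <;> simp

theorem bitSign_parity {M : Type} (S : Finset M) (s : Bits M) :
    (bitSign (parity S s) : R) = ∏ u ∈ S, bitSign (s u) := by
  have h : ∏ u ∈ S, (bitSign (s u) : R) = (-1) ^ (S.filter fun u => s u = true).card := by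
    simp [bitSign, Finset.prod_ite]
  rw [h]
  rcases Nat.even_or_odd (S.filter fun u => s u = true).card with h | h
  · simp [parity, h, Nat.not_odd_iff_even.mpr h]
  · simp [parity, h]

/-- The Walsh character `(-1)^(a·z)`. Its frequency `a` is a bit string rather than a set, so that
it is symmetric in `a` and `z`. -/
def walsh {ι : Type} [Fintype ι] (a z : Bits ι) : R := ∏ i, bitSign (a i && z i)

variable {ι : Type} [Fintype ι]

@[simp, norm_cast] theorem ofReal_walsh (a z : Bits ι) : ((walsh a z : ℝ) : ℂ) = walsh a z := by
  simp [walsh]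

theorem walsh_comm (a z : Bits ι) : (walsh a z : R) = walsh z a := by
  simp only [walsh, Bool.and_comm]

theorem walsh_symmDiff (a z w : Bits ι) : (walsh a (z ∆ w) : R) = walsh a z * walsh a w := by
  simp only [walsh, Pi.symmDiff_apply, Bool.symmDiff_eq_xor, Bool.and_xor_distrib_left,
    bitSign_xor, Finset.prod_mul_distrib]

theorem symmDiff_walsh (a b z : Bits ι) : (walsh (a ∆ b) z : R) = walsh a z * walsh b z := by
  simp only [walsh_comm _ z, walsh_symmDiff]

theorem walsh_mul_self (a z : Bits ι) : (walsh a z * walsh a z : R) = 1 := by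
  rw [← walsh_symmDiff]
  simp [walsh]

theorem norm_walsh (a z : Bits ι) : ‖(walsh a z : ℂ)‖ = 1 := by
  simp [walsh, norm_prod, norm_bitSign]

@[simp] theorem walsh_false (z : Bits ι) : (walsh (fun _ => false) z : R) = 1 := by
  simp [walsh]

@[simp] theorem walsh_decide_eq [DecidableEq ι] (i : ι) (z : Bits ι) :
    (walsh (fun k => decide (k = i)) z : R) = bitSign (z i) := by
  rw [walsh, Fintype.prod_eq_single i fun k hk => by simp [hk]]
  simp

theorem walsh_sum {κ : Type} [Fintype κ] (a z : Bits (ι ⊕ κ)) :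
    (walsh a z : R) = walsh (a ∘ Sum.inl) (z ∘ Sum.inl) * walsh (a ∘ Sum.inr) (z ∘ Sum.inr) :=
  Fintype.prod_sum_type _

theorem bitSign_parity_filter (a s : Bits ι) :
    (bitSign (parity (Finset.univ.filter fun i => a i = true) s) : R) = walsh a s := by
  simp only [bitSign_parity, Finset.prod_filter, ite_bitSign, walsh]

theorem sum_walsh_mul_walsh [DecidableEq ι] (z w : Bits ι) :
    ∑ a, (walsh a z * walsh a w : R) = if z = w then 2 ^ Fintype.card ι else 0 := by
  have hfactor (i : ι) :
      ∑ b : Bool, (bitSign (b && (z ∆ w) i) : R) = if z i = w i then 2 else 0 := by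
    cases hz : z i <;> cases hw : w i <;>
      norm_num [hz, hw, Bool.symmDiff_eq_xor]
  simp_rw [← walsh_symmDiff, walsh]
  rw [← Fintype.prod_sum fun i b => (bitSign (b && (z ∆ w) i) : R)]
  simp_rw [hfactor, Finset.prod_ite_zero, funext_iff]
  simp

theorem sum_walsh_mul_symmDiff [DecidableEq ι] (y v o q : Bits ι) (F : Bits ι → R) :
    walsh y (o ∆ q) * walsh y v * ∑ w, walsh q w * walsh v w * walsh w (o ∆ q) * F (w ∆ y) =
      walsh y q * ∑ w, walsh w v * walsh w o * F w := by
  rw [← Equiv.sum_comp (symmDiff_left_involutive y).toPerm, Finset.mul_sum, Finset.mul_sum]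
  refine Finset.sum_congr rfl fun w _ => ?_
  have hsign : (walsh y (o ∆ q) * walsh y v *
      (walsh q (w ∆ y) * walsh v (w ∆ y) * walsh (w ∆ y) (o ∆ q)) : R) =
        walsh y q * (walsh w v * walsh w o) := by
    calc
      _ = (walsh y o * walsh y o) * (walsh y v * walsh y v) * (walsh w q * walsh w q) *
          (walsh y q * walsh y q) * (walsh y q * (walsh w v * walsh w o)) := by
        simp only [walsh_comm q, walsh_comm v, walsh_symmDiff, symmDiff_walsh]
        ring
      _ = walsh y q * (walsh w v * walsh w o) := by simp only [walsh_mul_self, one_mul]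
  rw [Function.Involutive.coe_toPerm, symmDiff_symmDiff_cancel_right, ← mul_assoc, hsign]
  ring

theorem sum_walsh_mul_walsh_sumElim [DecidableEq ι] {κ : Type} [Fintype κ] (x : Bits κ)
    (y v o d : Bits ι) (b : Bits (κ ⊕ ι)) (F : Bits ι → R) :
    walsh (b ∘ Sum.inl) x * walsh y (o ∆ (d ∆ (b ∘ Sum.inr))) * (walsh y v *
        ∑ w, walsh d w * walsh v w * walsh w (o ∆ (d ∆ (b ∘ Sum.inr))) *
          (walsh b (Sum.elim x w) * F (w ∆ y))) =
      walsh y (d ∆ (b ∘ Sum.inr)) * ∑ w, walsh w v * walsh w o * F w := by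
  have hterm (w : Bits ι) :
      (walsh d w * walsh v w * walsh w (o ∆ (d ∆ (b ∘ Sum.inr))) *
          (walsh b (Sum.elim x w) * F (w ∆ y)) : R) =
        walsh (b ∘ Sum.inl) x * (walsh (d ∆ (b ∘ Sum.inr)) w * walsh v w *
          walsh w (o ∆ (d ∆ (b ∘ Sum.inr))) * F (w ∆ y)) := by
    rw [walsh_sum, Sum.elim_comp_inl, Sum.elim_comp_inr, symmDiff_walsh]
    ring
  rw [← sum_walsh_mul_symmDiff, Finset.sum_congr rfl fun w _ => hterm w, ← Finset.mul_sum]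
  linear_combination (walsh y (o ∆ (d ∆ (b ∘ Sum.inr))) * walsh y v *
    ∑ w, walsh (d ∆ (b ∘ Sum.inr)) w * walsh v w * walsh w (o ∆ (d ∆ (b ∘ Sum.inr))) *
      F (w ∆ y)) * walsh_mul_self (R := R) (b ∘ Sum.inl) x

/-- The coefficients of the expansion of `g` in Walsh characters. -/
def walshCoeff [DecidableEq ι] (g : Bits ι → ℝ) (a : Bits ι) : ℝ :=
  (∑ z, g z * walsh a z) / 2 ^ Fintype.card ι

/-- The real function `∑ₖ cₖ (-1)^(κₖ·z)` on bit strings. -/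
def walshSum {K : Type} [Fintype K] (κ : K → Bits ι) (c : K → ℝ) (z : Bits ι) : ℝ :=
  ∑ k, c k * walsh (κ k) z

theorem walshSum_walshCoeff [DecidableEq ι] (g : Bits ι → ℝ) : walshSum id (walshCoeff g) = g := by
  funext w
  calc walshSum id (walshCoeff g) w
      = ∑ a, (∑ z, g z * (walsh a z * walsh a w)) / 2 ^ Fintype.card ι := by
        refine Finset.sum_congr rfl fun a _ => ?_
        rw [walshCoeff, div_mul_eq_mul_div, Finset.sum_mul]
        simp only [mul_assoc, id]
    _ = (∑ z, g z * ∑ a, walsh a z * walsh a w) / 2 ^ Fintype.card ι := by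
        simp only [← Finset.sum_div, Finset.mul_sum]
        rw [Finset.sum_comm]
    _ = g w := by simp [sum_walsh_mul_walsh]

end Walsh

section BitStrings

theorem sum_bits_sum {A B : Type} [Fintype A] [Fintype B] [DecidableEq A] [DecidableEq B]
    {N : Type*} [AddCommMonoid N] (F : Bits (A ⊕ B) → N) :
    ∑ z, F z = ∑ a : Bits A, ∑ b : Bits B, F (Sum.elim a b) := by
  rw [← Fintype.sum_prod_type']
  exact ((Equiv.sumArrowEquivProdArrow A B Bool).symm.sum_comp F).symm

theorem sum_bits_sum_bits_prod {K N : Type*} [Fintype K] [DecidableEq K] [CommSemiring N]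
    (F : K → Bool → Bool → N) :
    ∑ a : K → Bool, ∑ b : K → Bool, ∏ k, F k (a k) (b k) =
      ∏ k, ∑ a : Bool, ∑ b : Bool, F k a b := by
  simp_rw [Fintype.prod_sum]

end BitStrings

theorem prod_edgeFinset_fromRel {V N : Type*} [Fintype V] [CommMonoid N] (r : V → V → Prop)
    [DecidableRel r] [Fintype (SimpleGraph.fromRel r).edgeSet] (hr : ∀ u v, r u v → ¬ r v u)
    (F : Sym2 V → N) :
    ∏ e ∈ (SimpleGraph.fromRel r).edgeFinset, F e = ∏ u, ∏ v, if r u v then F s(u, v) else 1 := by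
  rw [← Fintype.prod_prod_type' (f := fun u v => if r u v then F s(u, v) else 1),
    ← Finset.prod_filter (fun p : V × V => r p.1 p.2) fun p => F s(p.1, p.2)]
  symm
  refine Finset.prod_bij (fun p _ => s(p.1, p.2)) ?_ ?_ ?_ fun _ _ => rfl
  · rintro ⟨u, v⟩ huv
    have huv : r u v := by simpa using huv
    have hne : u ≠ v := fun h => hr u v huv (h ▸ huv)
    simp [huv, hne]
  · rintro ⟨u, v⟩ huv ⟨u', v'⟩ huv' he
    have huv : r u v := by simpa using huv
    have huv' : r u' v' := by simpa using huv'
    rcases Sym2.eq_iff.mp he with ⟨rfl, rfl⟩ | ⟨rfl, rfl⟩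
    · rfl
    · exact absurd huv' (hr _ _ huv)
  · rintro ⟨u, v⟩ he
    have he : u ≠ v ∧ (r u v ∨ r v u) := by simpa using he
    rcases he.2 with h | h
    · exact ⟨(u, v), by simpa using h, rfl⟩
    · exact ⟨(v, u), by simpa using h, Sym2.eq_swap⟩

section Gates

theorem one_div_sqrt_two_mul_self :
    (1 / (Real.sqrt 2 : ℂ)) * (1 / (Real.sqrt 2 : ℂ)) = 1 / 2 := by
  rw [div_mul_div_comm, ← Complex.ofReal_mul, Real.mul_self_sqrt zero_le_two]
  norm_num

theorem ite_pauliX_mul_ite_pauliZ_apply (p q a b : Bool) :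
    ((if p then pauliX else 1) * (if q then pauliZ else 1) : Matrix Bool Bool ℂ) a b =
      if b = xor a p then bitSign (q && b) else 0 := by
  cases p <;> cases q <;> cases a <;> cases b <;>
    simp [pauliX, pauliZ, Matrix.mul_apply, Matrix.diagonal_apply]

theorem braMeas_eq (θ : ℝ) (s b : Bool) :
    braMeas θ s b = (1 / (Real.sqrt 2 : ℂ)) *
      (bitSign (s && b) * if b then Complex.exp (-(Complex.I * θ)) else 1) := by
  cases b <;> cases s <;> simp [braMeas]

/-- The Hadamard gate. -/
def hadamardGate : Matrix Bool Bool ℂ :=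
  Matrix.of fun a b => (1 / (Real.sqrt 2 : ℂ)) * bitSign (a && b)

/-- The gate that applies a Hadamard gate to every qubit of the second register. -/
def hadamardRight (I J : Type) [Fintype I] [Fintype J] :
    Matrix (Bits (I ⊕ J)) (Bits (I ⊕ J)) ℂ :=
  tensor (Sum.elim (fun _ => 1) fun _ => hadamardGate)

/-- The diagonal unitary `|z⟩ ↦ exp(i g(z)) |z⟩`. -/
def phaseGate {V : Type} [Fintype V] (g : Bits V → ℝ) :
    Matrix (Bits V) (Bits V) ℂ :=
  Matrix.diagonal fun z => Complex.exp (Complex.I * g z)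

variable {I J : Type} [Fintype I] [Fintype J]

theorem hadamardRight_apply (z w : Bits (I ⊕ J)) :
    hadamardRight I J z w = if z ∘ Sum.inl = w ∘ Sum.inl then
      (1 / (Real.sqrt 2 : ℂ)) ^ Fintype.card J * walsh (z ∘ Sum.inr) (w ∘ Sum.inr) else 0 := by
  simp only [hadamardRight, tensor, hadamardGate, Matrix.of_apply, Fintype.prod_sum_type,
    Sum.elim_inl, Sum.elim_inr, Matrix.one_apply, Finset.prod_ite_zero, Finset.prod_const_one,
    Finset.prod_mul_distrib, Finset.prod_const, Finset.card_univ, walsh, funext_iff,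
    Function.comp_apply, Finset.mem_univ, true_implies, ite_mul, one_mul, zero_mul]

theorem hadamardRight_mul_phaseGate_mul_hadamardRight_apply [DecidableEq I] [DecidableEq J]
    (g : Bits (I ⊕ J) → ℝ) (out v : Bits (I ⊕ J)) :
    (hadamardRight I J * phaseGate g * hadamardRight I J) out v =
      if out ∘ Sum.inl = v ∘ Sum.inl then
        (1 / 2) ^ Fintype.card J * ∑ w, walsh w (v ∘ Sum.inr) * walsh w (out ∘ Sum.inr) *
          Complex.exp (Complex.I * g (Sum.elim (v ∘ Sum.inl) w))
      else 0 := by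
  have hterm (x : Bits I) (w : Bits J) :
      (hadamardRight I J * phaseGate g) out (Sum.elim x w) * hadamardRight I J (Sum.elim x w) v =
        if x = v ∘ Sum.inl then if out ∘ Sum.inl = v ∘ Sum.inl then
          (1 / 2) ^ Fintype.card J * (walsh w (v ∘ Sum.inr) * walsh w (out ∘ Sum.inr) *
            Complex.exp (Complex.I * g (Sum.elim (v ∘ Sum.inl) w))) else 0 else 0 := by
    rw [phaseGate, Matrix.mul_diagonal, hadamardRight_apply, hadamardRight_apply,
      Sum.elim_comp_inl, Sum.elim_comp_inr]
    have hpow : (1 / 2 : ℂ) ^ Fintype.card J =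
        (1 / (Real.sqrt 2 : ℂ)) ^ Fintype.card J * (1 / (Real.sqrt 2 : ℂ)) ^ Fintype.card J := by
      rw [← mul_pow, one_div_sqrt_two_mul_self]
    by_cases hx : x = v ∘ Sum.inl
    · subst hx
      by_cases hout : out ∘ Sum.inl = v ∘ Sum.inl
      · simp only [hout, if_true, hpow, walsh_comm (out ∘ Sum.inr)]
        ring
      · simp only [hout, if_false, zero_mul, ite_self]
    · simp only [hx, if_false, mul_zero]
  rw [Matrix.mul_apply, sum_bits_sum]
  simp only [hterm, Finset.sum_ite_irrel, Finset.sum_const_zero, Fintype.sum_ite_eq',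
    Finset.mul_sum]

end Gates

theorem not_transGen_self_of_lt {α β : Type*} [Preorder β] {r : α → α → Prop} (rank : α → β)
    (hrank : ∀ a b, r a b → rank a < rank b) (a : α) : ¬ Relation.TransGen r a a := fun h =>
  lt_irrefl (rank a) <| by
    simpa only [Relation.transGen_eq_self] using h.lift (p := (· < ·)) rank hrank

namespace Pattern

variable {I O : Type} (P : Pattern I O)

theorem depth_le_card {β : Type*} [Fintype β] [Preorder β] (rank : P.Qubit → β)
    (hrank : ∀ a b, P.Dep a b → rank a < rank b) : P.depth ≤ Fintype.card β := by
  refine iSup₂_le fun l hl => ?_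
  have hchain : (l.map rank).IsChain (· < ·) := by
    rw [List.isChain_map]
    exact hl.imp hrank
  have hnodup : (l.map rank).Nodup := (List.isChain_iff_pairwise.mp hchain).imp fun h => h.ne
  exact_mod_cast List.length_map (as := l) rank ▸ hnodup.length_le_card

/-- The output qubits that get an `X` correction if the outcomes are `s`. -/
def xCorrection (s : Bits P.M) : Bits O := fun o => parity (P.xSignal (Sum.inr o)) s

/-- The output qubits that get a `Z` correction if the outcomes are `s`. -/
def zCorrection (s : Bits P.M) : Bits O := fun o => parity (P.zSignal (Sum.inr o)) s

variable [Fintype O]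

theorem correct_apply (s : Bits P.M) (out o : Bits O) :
    P.correct s out o = if o = out ∆ P.xCorrection s then walsh (P.zCorrection s) o else 0 := by
  simp only [correct, tensor, Matrix.of_apply, ite_pauliX_mul_ite_pauliZ_apply]
  rw [Finset.prod_ite_zero]
  simp [funext_iff, xCorrection, zCorrection, walsh, Bool.symmDiff_eq_xor]

variable [DecidableEq O]

theorem prepare_apply [Fintype I] (z : Bits P.Qubit) (v : Bits I) :
    P.prepare z v = if z ∘ P.input = v then
      (1 / (Real.sqrt 2 : ℂ)) ^ (Fintype.card P.Qubit - Fintype.card I) else 0 := by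
  have h : Finset.univ.filter (fun v => ∀ i, P.input i ≠ v) = (Finset.univ.map P.input)ᶜ := by
    ext v
    simp
  simp only [prepare, Matrix.of_apply, ketPlus, Finset.prod_const, h, Finset.card_compl,
    Finset.card_map, Finset.card_univ]
  rfl

theorem branch_apply [Fintype I] (s : Bits P.M) (out : Bits O) (v : Bits I) :
    P.branch s out v = walsh (P.zCorrection s) (out ∆ P.xCorrection s) * ∑ z : Bits P.M,
      (∏ u, braMeas (P.actualAngle s u) (s u) (z u)) *
        (P.entangle (Sum.elim z (out ∆ P.xCorrection s)) (Sum.elim z (out ∆ P.xCorrection s)) *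
          P.prepare (Sum.elim z (out ∆ P.xCorrection s)) v) := by
  have hmeasure (y : Bits O) (z : Bits P.M) (o : Bits O) : P.measure s y (Sum.elim z o) =
      if o = y then ∏ u, braMeas (P.actualAngle s u) (s u) (z u) else 0 := rfl
  have hcorrect (z : Bits P.M) (o : Bits O) : (P.correct s * P.measure s) out (Sum.elim z o) =
      if o = out ∆ P.xCorrection s then
        walsh (P.zCorrection s) o * ∏ u, braMeas (P.actualAngle s u) (s u) (z u) else 0 := by
    simp only [Matrix.mul_apply, correct_apply, hmeasure, mul_ite, mul_zero, ite_mul, zero_mul,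
      Fintype.sum_ite_eq]
  rw [branch, Matrix.mul_apply, sum_bits_sum]
  simp only [entangle, Matrix.mul_diagonal, hcorrect, ite_mul, zero_mul, Fintype.sum_ite_eq',
    Matrix.diagonal_apply_eq, Finset.mul_sum, mul_assoc]

theorem entangle_apply_self (r : P.Qubit → P.Qubit → Bool)
    (hgraph : P.graph = SimpleGraph.fromRel fun u v => r u v = true)
    (hr : ∀ u v, r u v = true → ¬ r v u = true) (z : Bits P.Qubit) :
    P.entangle z z = ∏ u, if z u then walsh (r u) z else 1 := by
  classical
  have hedge : P.graph.edgeFinset = (SimpleGraph.fromRel fun u v => r u v = true).edgeFinset := by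
    ext e
    simp only [SimpleGraph.mem_edgeFinset, hgraph]
  rw [entangle, Matrix.diagonal_apply_eq, hedge, prod_edgeFinset_fromRel _ hr]
  refine Finset.prod_congr rfl fun u _ => ?_
  simp only [Sym2.mem_iff, forall_eq_or_imp, forall_eq]
  cases z u
  · simp
  · refine Finset.prod_congr rfl fun v _ => ?_
    cases r u v <;> cases z v <;> simp

theorem implements_of_branch [Fintype I] [DecidableEq I] {U : Matrix (Bits O) (Bits I) ℂ}
    (c : Bits P.M → ℂ) (hbranch : ∀ s, P.branch s = c s • U) (hc : ∑ s, ‖c s‖ ^ 2 = 1) :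
    P.Implements U := by
  intro ρ
  have hterm (s : Bits P.M) :
      P.branch s * ρ * (P.branch s)ᴴ = ((‖c s‖ ^ 2 : ℝ) : ℂ) • (U * ρ * Uᴴ) := by
    rw [hbranch, Matrix.conjTranspose_smul, Matrix.smul_mul, Matrix.smul_mul, Matrix.mul_smul,
      smul_smul, Complex.star_def, Complex.mul_conj', Complex.ofReal_pow]
  rw [channel, Finset.sum_congr rfl fun s _ => hterm s, ← Finset.sum_smul, ← Complex.ofReal_sum,
    hc, Complex.ofReal_one, one_smul]

end Pattern

section PhaseGadget

/-- Given the outcome `p` of the axle, only one value `b` of the leaf interferes constructively,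
namely the one with `(-1)^b = (-1)^p (-1)^t`. -/
theorem sum_gadget (p q t : Bool) (τ : ℂ) :
    ∑ a : Bool, ∑ b : Bool, (if a then bitSign b * bitSign t else 1) *
      (bitSign (p && a) * (bitSign (q && b) *
        if b then Complex.exp (-(Complex.I * (bitSign p * (2 * τ)))) else 1)) =
      2 * (Complex.exp (-(Complex.I * (bitSign p * τ))) * bitSign (p && q)) *
        ((if q then bitSign t else 1) * Complex.exp (Complex.I * (τ * bitSign t))) := by
  have haxle (b : Bool) (x : ℂ) : ∑ a : Bool, (if a then bitSign b * bitSign t else 1) *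
      (bitSign (p && a) * x) = if b = xor p t then 2 * x else 0 := by
    cases b <;> cases p <;> cases t <;> simp [two_mul]
  have hleaf : (if xor p t then Complex.exp (-(Complex.I * (bitSign p * (2 * τ)))) else 1) =
      Complex.exp (-(Complex.I * (bitSign p * τ))) *
        Complex.exp (Complex.I * (τ * bitSign t)) := by
    rw [← Complex.exp_add]
    cases p <;> cases t <;> simp [two_mul, mul_add]
  have hsign : (bitSign (q && xor p t) : ℂ) = bitSign (p && q) * if q then bitSign t else 1 := by
    cases q <;> simp [bitSign_xor]
  rw [Finset.sum_comm]
  simp only [haxle, Fintype.sum_ite_eq']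
  rw [hleaf, hsign]
  ring

variable {I J K : Type} [Fintype K]

/-- The Pauli `Z` operators that the outcomes `b` of the leaves leave on the qubits of the
gadgets. -/
def gadgetByproduct {V : Type} (κ : K → Bits V) (b : Bits K) : Bits V :=
  fun v => parity (Finset.univ.filter fun k => κ k v = true) b

theorem walsh_gadgetByproduct {V : Type} [Fintype V] {R : Type*} [CommRing R] (κ : K → Bits V)
    (b : Bits K) (z : Bits V) :
    (walsh (gadgetByproduct κ b) z : R) = ∏ k, if b k then walsh (κ k) z else 1 := by
  have hleft (v : V) : (bitSign (gadgetByproduct κ b v && z v) : R) =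
      ∏ k, if b k then bitSign (κ k v && z v) else 1 := by
    cases hz : z v
    · simp
    · simp only [Bool.and_true, gadgetByproduct, bitSign_parity_filter, walsh]
      exact Finset.prod_congr rfl fun k _ => by cases b k <;> simp
  have hright (k : K) : (if b k then walsh (κ k) z else 1 : R) =
      ∏ v, if b k then bitSign (κ k v && z v) else 1 := by
    cases b k <;> simp [walsh]
  simp_rw [walsh, hleft]
  rw [Finset.prod_comm]
  exact Finset.prod_congr rfl fun k _ => (hright k).symm

variable [Fintype J] (κ : K → Bits (I ⊕ J)) (c : K → ℝ) (y : Bits J) (p q : Bits K)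

/-- The angle `τₖ` of the phase `exp(i τₖ (-1)^(κₖ·z))` that the gadget `k` has to perform, given
the byproduct operator `X^y` on the second register. -/
def gadgetAngle (κ : K → Bits (I ⊕ J)) (c : K → ℝ) (y : Bits J) (k : K) : ℝ :=
  c k * walsh (κ k ∘ Sum.inr) y

theorem sum_gadgetAngle_mul_walsh [Fintype I] (x : Bits I) (w : Bits J) :
    ∑ k, gadgetAngle κ c y k * walsh (κ k) (Sum.elim x w) =
      walshSum κ c (Sum.elim x (w ∆ y)) := by
  refine Finset.sum_congr rfl fun k _ => ?_
  simp only [gadgetAngle, walsh_sum, Sum.elim_comp_inl, Sum.elim_comp_inr, walsh_symmDiff]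
  ring

/-- The scalar by which the gadgets multiply the state if the outcomes of their axles and leaves are
`p` and `q`, apart from the phases and the byproduct operators that they perform. -/
def gadgetScalar : ℂ :=
  ∏ k, 2 * (Complex.exp (-(Complex.I * (bitSign (p k) * gadgetAngle κ c y k))) *
    bitSign (p k && q k))

theorem norm_gadgetScalar : ‖gadgetScalar κ c y p q‖ = 2 ^ Fintype.card K := by
  have hexp (b : Bool) (τ : ℝ) : ‖Complex.exp (-(Complex.I * (bitSign b * τ)))‖ = 1 := by
    simpa [mul_comm] using Complex.norm_exp_ofReal_mul_I (-(bitSign b * τ))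
  simp [gadgetScalar, norm_prod, hexp, norm_bitSign]

/-- The amplitude that the gadgets contribute if the outcomes of their axles and leaves are `p` and
`q`, the computational basis states of the axles and leaves are `a` and `b`, and those of the two
registers are `x` and `w`. -/
def gadgetAmplitude [Fintype I] (x : Bits I) (w : Bits J) (a b : Bits K) : ℂ :=
  (∏ k, if a k then bitSign (b k) * walsh (κ k) (Sum.elim x w) else 1) *
    ∏ k, bitSign (p k && a k) * (bitSign (q k && b k) *
      if b k then
        Complex.exp (-(Complex.I * (bitSign (p k) * (2 * gadgetAngle κ c y k)))) else 1)

theorem sum_gadgetAmplitude [Fintype I] [DecidableEq K] (x : Bits I) (w : Bits J) :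
    ∑ a : Bits K, ∑ b : Bits K, gadgetAmplitude κ c y p q x w a b =
      gadgetScalar κ c y p q * (walsh (gadgetByproduct κ q) (Sum.elim x w) *
        Complex.exp (Complex.I * walshSum κ c (Sum.elim x (w ∆ y)))) := by
  have hgadget (k : K) := sum_gadget (p k) (q k)
    (parity (Finset.univ.filter fun i => κ k i = true) (Sum.elim x w)) (gadgetAngle κ c y k)
  simp only [bitSign_parity_filter] at hgadget
  have hsum := (sum_bits_sum_bits_prod _).trans (Finset.prod_congr rfl fun k _ => hgadget k)
  simp only [gadgetAmplitude, ← Finset.prod_mul_distrib]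
  rw [hsum, Finset.prod_mul_distrib, gadgetScalar,
    Finset.prod_mul_distrib (f := fun k => if q k then _ else _), ← walsh_gadgetByproduct,
    ← sum_gadgetAngle_mul_walsh, Complex.ofReal_sum, Finset.mul_sum, Complex.exp_sum]
  simp only [Complex.ofReal_mul, ofReal_walsh]

end PhaseGadget

/-- The measured qubits of the phase pattern on registers `I` and `J` with gadgets `K`: the inputs
of the second register, the qubits onto which a first Hadamard gate teleports them, and for each
phase gadget its axle, which is joined to the qubits it acts on, and its leaf, which is joined to
the axle only. -/
inductive MeasuredQubit (J K : Type) : Type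
  | source (j : J)
  | middle (j : J)
  | axle (k : K)
  | leaf (k : K)

namespace MeasuredQubit

variable {J K : Type}

/-- The measured qubits as a disjoint union of their four kinds; this makes them a finite type. -/
def equivSum : MeasuredQubit J K ≃ (J ⊕ J) ⊕ (K ⊕ K) where
  toFun
    | source j => .inl (.inl j)
    | middle j => .inl (.inr j)
    | axle k => .inr (.inl k)
    | leaf k => .inr (.inr k)
  invFun := Sum.elim (Sum.elim source middle) (Sum.elim axle leaf)
  left_inv := by rintro (_ | _ | _ | _) <;> rfl
  right_inv := by rintro ((_ | _) | (_ | _)) <;> rfl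

instance [DecidableEq J] [DecidableEq K] : DecidableEq (MeasuredQubit J K) :=
  equivSum.decidableEq

variable [Fintype J] [Fintype K]

instance : Fintype (MeasuredQubit J K) := .ofEquiv _ equivSum.symm

theorem card_eq : Fintype.card (MeasuredQubit J K) = 2 * (Fintype.card J + Fintype.card K) := by
  rw [Fintype.card_congr equivSum]
  simp only [Fintype.card_sum]
  ring

theorem prod_univ {N : Type*} [CommMonoid N] (F : MeasuredQubit J K → N) :
    ∏ u, F u =
      (∏ j, F (source j)) * (∏ j, F (middle j)) * ((∏ k, F (axle k)) * ∏ k, F (leaf k)) := by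
  rw [← equivSum.symm.prod_comp]
  simp only [Fintype.prod_sum_type]
  rfl

theorem walsh_eq {R : Type*} [CommRing R] (a s : Bits (MeasuredQubit J K)) :
    (walsh a s : R) = walsh (a ∘ source) (s ∘ source) * walsh (a ∘ middle) (s ∘ middle) *
      (walsh (a ∘ axle) (s ∘ axle) * walsh (a ∘ leaf) (s ∘ leaf)) :=
  prod_univ _

theorem sum_bits [DecidableEq J] [DecidableEq K] {N : Type*} [AddCommMonoid N]
    (F : Bits J → Bits J → Bits K → Bits K → N) :
    ∑ z : Bits (MeasuredQubit J K), F (z ∘ source) (z ∘ middle) (z ∘ axle) (z ∘ leaf) =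
      ∑ y, ∑ w, ∑ a, ∑ b, F y w a b := by
  rw [← (equivSum.arrowCongr (Equiv.refl Bool)).symm.sum_comp]
  simp_rw [sum_bits_sum]
  rfl

end MeasuredQubit

open MeasuredQubit

section PhasePattern

variable {I J K : Type}

/-- The edges of the phase pattern, each with one orientation. The axle of the gadget `k` is joined
to the qubits that occur in `κ k`, where the second register is taken between its two Hadamard
gates. -/
def phaseEdge [DecidableEq J] [DecidableEq K] (κ : K → Bits (I ⊕ J)) :
    MeasuredQubit J K ⊕ (I ⊕ J) → MeasuredQubit J K ⊕ (I ⊕ J) → Bool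
  | .inl (source j), .inl (middle j') => j' = j
  | .inl (middle j), .inr (.inr j') => j' = j
  | .inl (axle k), .inl (leaf k') => k' = k
  | .inl (axle k), .inr (.inl i) => κ k (.inl i)
  | .inl (axle k), .inl (middle j) => κ k (.inr j)
  | _, _ => false

/-- The measured qubits on which the sign of the angle, or the `X` correction, of a qubit
depends. -/
def phaseXDep [DecidableEq J] [DecidableEq K] (κ : K → Bits (I ⊕ J)) :
    MeasuredQubit J K ⊕ (I ⊕ J) → Bits (MeasuredQubit J K)
  | .inl (leaf k), source j => κ k (.inr j)
  | .inl (leaf k), axle k' => k' = k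
  | .inr (.inr j), middle j' => j' = j
  | .inr (.inr j), leaf k => κ k (.inr j)
  | _, _ => false

/-- The measured qubits on which the `Z` correction of a qubit depends. -/
def phaseZDep [DecidableEq J] (κ : K → Bits (I ⊕ J)) :
    MeasuredQubit J K ⊕ (I ⊕ J) → Bits (MeasuredQubit J K)
  | .inr (.inl i), leaf k => κ k (.inl i)
  | .inr (.inr j), source j' => j' = j
  | _, _ => false

/-- The time step in which a qubit of the phase pattern is measured, or corrected. -/
def phaseStep : MeasuredQubit J K ⊕ (I ⊕ J) → Fin 3
  | .inl (leaf _) => 1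
  | .inl _ => 0
  | .inr _ => 2

variable [DecidableEq J] [DecidableEq K] (κ : K → Bits (I ⊕ J))

theorem phaseEdge_asymm (u v : MeasuredQubit J K ⊕ (I ⊕ J)) (h : phaseEdge κ u v = true) :
    ¬ phaseEdge κ v u = true := by
  rcases u with (_ | _ | _ | _) | (_ | _) <;> rcases v with (_ | _ | _ | _) | (_ | _) <;>
    simp_all [phaseEdge]

theorem phaseStep_lt (u : MeasuredQubit J K) (v : MeasuredQubit J K ⊕ (I ⊕ J))
    (h : phaseXDep κ v u = true ∨ phaseZDep κ v u = true) :
    phaseStep (.inl u : MeasuredQubit J K ⊕ (I ⊕ J)) < phaseStep v := by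
  rcases u with _ | _ | _ | _ <;> rcases v with (_ | _ | _ | _) | (_ | _) <;>
    simp_all [phaseXDep, phaseZDep, phaseStep]

variable [Fintype J] [Fintype K]

/-- The pattern that performs `exp(i ∑ₖ cₖ (-1)^(κₖ·z))`, conjugated by Hadamard gates on the
second register. It is an abbreviation so that its qubits are known to be `MeasuredQubit J K`. -/
abbrev phasePattern (c : K → ℝ) : Pattern (I ⊕ J) (I ⊕ J) where
  M := MeasuredQubit J K
  graph := SimpleGraph.fromRel fun u v => phaseEdge κ u v = true
  decAdj := Classical.decRel _
  input :=
    { toFun := Sum.elim (fun i => .inr (.inl i)) fun j => .inl (source j)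
      inj' := by rintro (_ | _) (_ | _) h <;> simp_all }
  angle
    | leaf k => 2 * c k
    | _ => 0
  xSignal v := Finset.univ.filter fun u => phaseXDep κ v u = true
  zSignal v := Finset.univ.filter fun u => phaseZDep κ v u = true
  acyclic := not_transGen_self_of_lt phaseStep <| by
    rintro _ v ⟨u, rfl, hu⟩
    exact phaseStep_lt κ u v (by simpa using hu)

variable (c : K → ℝ)

theorem depth_phasePattern_le : (phasePattern κ c).depth ≤ 3 :=
  (phasePattern κ c).depth_le_card phaseStep <| by
    rintro _ v ⟨u, rfl, hu⟩
    exact phaseStep_lt κ u v (by simpa using hu)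

variable (s : Bits (MeasuredQubit J K))

theorem xCorrection_phasePattern : (phasePattern κ c).xCorrection s =
    Sum.elim (fun _ => false) ((s ∘ middle) ∆ (gadgetByproduct κ (s ∘ leaf) ∘ Sum.inr)) := by
  funext v
  apply bitSign_injective
  rw [Pattern.xCorrection, bitSign_parity_filter, walsh_eq]
  rcases v with i | j
  · simp [Function.comp_def, phaseXDep]
  · simp [Function.comp_def, phaseXDep, Bool.symmDiff_eq_xor, bitSign_xor, gadgetByproduct,
      bitSign_parity_filter]

theorem zCorrection_phasePattern : (phasePattern κ c).zCorrection s =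
    Sum.elim (gadgetByproduct κ (s ∘ leaf) ∘ Sum.inl) (s ∘ source) := by
  funext v
  apply bitSign_injective
  rw [Pattern.zCorrection, bitSign_parity_filter, walsh_eq]
  rcases v with i | j
  · simp [Function.comp_def, phaseZDep, gadgetByproduct, bitSign_parity_filter]
  · simp [Function.comp_def, phaseZDep]

theorem actualAngle_phasePattern_leaf (k : K) :
    (phasePattern κ c).actualAngle s (leaf k) =
      bitSign (s (axle k)) * (2 * gadgetAngle κ c (s ∘ source) k) := by
  have hsign (b : Bool) (x : ℝ) : (if b then -x else x) = bitSign b * x := by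
    cases b <;> simp
  rw [Pattern.actualAngle, hsign, bitSign_parity_filter, walsh_eq]
  simp only [phaseXDep, phaseZDep, Function.comp_def, gadgetAngle, parity, walsh_false,
    walsh_decide_eq, Bool.false_eq_true, Finset.filter_false, Finset.filter_empty,
    Finset.card_empty, Nat.not_odd_zero, decide_false, if_false]
  ring

theorem actualAngle_phasePattern_of_ne_leaf {u : MeasuredQubit J K} (hu : ∀ k, u ≠ leaf k) :
    (phasePattern κ c).actualAngle s u = 0 := by
  rcases u with _ | _ | _ | k
  · simp [Pattern.actualAngle, phaseZDep, parity]
  · simp [Pattern.actualAngle, phaseZDep, parity]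
  · simp [Pattern.actualAngle, phaseZDep, parity]
  · exact absurd rfl (hu k)

theorem prod_braMeas_phasePattern (z : Bits (MeasuredQubit J K)) :
    ∏ u, braMeas ((phasePattern κ c).actualAngle s u) (s u) (z u) =
      (1 / (Real.sqrt 2 : ℂ)) ^ Fintype.card (MeasuredQubit J K) *
        (walsh (s ∘ source) (z ∘ source) * walsh (s ∘ middle) (z ∘ middle) *
          ∏ k, bitSign (s (axle k) && z (axle k)) * (bitSign (s (leaf k) && z (leaf k)) *
            if z (leaf k) then Complex.exp (-(Complex.I *
              (bitSign (s (axle k)) * (2 * gadgetAngle κ c (s ∘ source) k)))) else 1)) := by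
  simp only [braMeas_eq, Finset.prod_mul_distrib, Finset.prod_const, Finset.card_univ]
  rw [MeasuredQubit.prod_univ, MeasuredQubit.prod_univ]
  simp only [walsh, Function.comp_apply, actualAngle_phasePattern_leaf]
  simp only [ne_eq, reduceCtorEq, not_false_eq_true, implies_true,
    actualAngle_phasePattern_of_ne_leaf, Complex.ofReal_zero, mul_zero, neg_zero, Complex.exp_zero,
    ite_self, Finset.prod_const_one, mul_one, Complex.ofReal_mul, ofReal_bitSign,
    Complex.ofReal_ofNat, one_mul]
  ring

/-- The scalar by which the operator of the branch with outcomes `s` differs from the unitary that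
the pattern performs. -/
def branchScalar (κ : K → Bits (I ⊕ J)) (c : K → ℝ) (s : Bits (MeasuredQubit J K)) : ℂ :=
  (1 / 2) ^ Fintype.card (MeasuredQubit J K) *
    gadgetScalar κ c (s ∘ source) (s ∘ axle) (s ∘ leaf) * 2 ^ Fintype.card J *
      walsh (s ∘ source) ((s ∘ middle) ∆ (gadgetByproduct κ (s ∘ leaf) ∘ Sum.inr))

theorem sum_norm_branchScalar_sq : ∑ s, ‖branchScalar κ c s‖ ^ 2 = 1 := by
  have hnorm (s : Bits (MeasuredQubit J K)) :
      ‖branchScalar κ c s‖ ^ 2 = (1 / 2) ^ Fintype.card (MeasuredQubit J K) := by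
    set n := Fintype.card J + Fintype.card K with hn
    have hhalf : (1 / 2 : ℝ) ^ n * 2 ^ n = 1 := by
      rw [← mul_pow, one_div_mul_cancel two_ne_zero, one_pow]
    simp only [branchScalar, norm_mul, norm_pow, norm_gadgetScalar, norm_walsh, norm_div, norm_one,
      Complex.norm_ofNat, MeasuredQubit.card_eq, ← hn, mul_one]
    calc ((1 / 2 : ℝ) ^ (2 * n) * 2 ^ Fintype.card K * 2 ^ Fintype.card J) ^ 2
        = ((1 / 2) ^ n * 2 ^ n) ^ 2 * (1 / 2) ^ (2 * n) := by rw [hn]; ring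
      _ = (1 / 2) ^ (2 * n) := by rw [hhalf, one_pow, one_mul]
  simp [hnorm]

variable [Fintype I] [DecidableEq I]

theorem entangle_phasePattern (z : Bits (MeasuredQubit J K)) (o : Bits (I ⊕ J)) :
    (phasePattern κ c).entangle (Sum.elim z o) (Sum.elim z o) =
      walsh (z ∘ source) (z ∘ middle) * walsh (z ∘ middle) (o ∘ Sum.inr) *
        ∏ k, if z (axle k) then
          bitSign (z (leaf k)) * walsh (κ k) (Sum.elim (o ∘ Sum.inl) (z ∘ middle)) else 1 := by
  have hsource (j : J) : (walsh (phaseEdge κ (.inl (source j))) (Sum.elim z o) : ℂ) =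
      bitSign (z (middle j)) := by
    simp [walsh_sum, MeasuredQubit.walsh_eq, Function.comp_def, phaseEdge]
  have hmiddle (j : J) : (walsh (phaseEdge κ (.inl (middle j))) (Sum.elim z o) : ℂ) =
      bitSign (o (.inr j)) := by
    simp [walsh_sum, Function.comp_def, phaseEdge]
  have haxle (k : K) : (walsh (phaseEdge κ (.inl (axle k))) (Sum.elim z o) : ℂ) =
      bitSign (z (leaf k)) * walsh (κ k) (Sum.elim (o ∘ Sum.inl) (z ∘ middle)) := by
    simp only [walsh_sum, MeasuredQubit.walsh_eq, Function.comp_def, phaseEdge, Sum.elim_inl,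
      Sum.elim_inr, walsh_false, walsh_decide_eq]
    ring
  have hleaf (k : K) : (walsh (phaseEdge κ (.inl (leaf k))) (Sum.elim z o) : ℂ) = 1 :=
    walsh_false _
  have hout (v : I ⊕ J) : (walsh (phaseEdge κ (.inr v)) (Sum.elim z o) : ℂ) = 1 :=
    walsh_false _
  rw [(phasePattern κ c).entangle_apply_self (phaseEdge κ) rfl (phaseEdge_asymm κ),
    Fintype.prod_sum_type, MeasuredQubit.prod_univ]
  simp only [Sum.elim_inl, Sum.elim_inr, hsource, hmiddle, haxle, hleaf, hout, ite_bitSign,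
    ite_self, Finset.prod_const_one, mul_one]
  rfl

theorem prepare_phasePattern (z : Bits (MeasuredQubit J K)) (o v : Bits (I ⊕ J)) :
    (phasePattern κ c).prepare (Sum.elim z o) v =
      if z ∘ source = v ∘ Sum.inr then if o ∘ Sum.inl = v ∘ Sum.inl then
        (1 / (Real.sqrt 2 : ℂ)) ^ Fintype.card (MeasuredQubit J K) else 0 else 0 := by
  have hinput : Sum.elim z o ∘ (phasePattern κ c).input =
      Sum.elim (o ∘ Sum.inl) (z ∘ source) := by
    funext v
    rcases v with i | j <;> rfl
  have hv : Sum.elim (o ∘ Sum.inl) (z ∘ source) = v ↔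
      z ∘ source = v ∘ Sum.inr ∧ o ∘ Sum.inl = v ∘ Sum.inl := by
    rw [and_comm, ← Sum.elim_eq_iff, Sum.elim_comp_inl_inr]
  rw [Pattern.prepare_apply, hinput, Fintype.card_sum, Nat.add_sub_cancel, ← ite_and]
  exact if_congr hv rfl rfl

theorem measured_term_phasePattern (z : Bits (MeasuredQubit J K)) (o v : Bits (I ⊕ J)) :
    (∏ u, braMeas ((phasePattern κ c).actualAngle s u) (s u) (z u)) *
        ((phasePattern κ c).entangle (Sum.elim z o) (Sum.elim z o) *
          (phasePattern κ c).prepare (Sum.elim z o) v) =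
      if z ∘ source = v ∘ Sum.inr then
        if o ∘ Sum.inl = v ∘ Sum.inl then
          (1 / 2) ^ Fintype.card (MeasuredQubit J K) * walsh (s ∘ source) (z ∘ source) *
            (walsh (s ∘ middle) (z ∘ middle) * walsh (z ∘ source) (z ∘ middle) *
              walsh (z ∘ middle) (o ∘ Sum.inr) *
              gadgetAmplitude κ c (s ∘ source) (s ∘ axle) (s ∘ leaf) (o ∘ Sum.inl) (z ∘ middle)
                (z ∘ axle) (z ∘ leaf))
        else 0
      else 0 := by
  rw [prepare_phasePattern]
  simp only [mul_ite, mul_zero]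
  refine if_congr Iff.rfl (if_congr Iff.rfl ?_ rfl) rfl
  rw [prod_braMeas_phasePattern, entangle_phasePattern, ← one_div_sqrt_two_mul_self, mul_pow]
  simp only [gadgetAmplitude, Function.comp_apply]
  ring

theorem sum_measured_phasePattern (o v : Bits (I ⊕ J)) :
    ∑ z : Bits (phasePattern κ c).M,
        (∏ u, braMeas ((phasePattern κ c).actualAngle s u) (s u) (z u)) *
          ((phasePattern κ c).entangle (Sum.elim z o) (Sum.elim z o) *
            (phasePattern κ c).prepare (Sum.elim z o) v) =
      if o ∘ Sum.inl = v ∘ Sum.inl then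
        (1 / 2) ^ Fintype.card (MeasuredQubit J K) *
          gadgetScalar κ c (s ∘ source) (s ∘ axle) (s ∘ leaf) * (walsh (s ∘ source) (v ∘ Sum.inr) *
            ∑ w, walsh (s ∘ middle) w * walsh (v ∘ Sum.inr) w * walsh w (o ∘ Sum.inr) *
              (walsh (gadgetByproduct κ (s ∘ leaf)) (Sum.elim (o ∘ Sum.inl) w) *
                Complex.exp (Complex.I *
                  walshSum κ c (Sum.elim (o ∘ Sum.inl) (w ∆ (s ∘ source))))))
      else 0 := by
  refine (Finset.sum_congr rfl fun z _ => measured_term_phasePattern κ c s z o v).trans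
    ((MeasuredQubit.sum_bits fun y w a b =>
      if y = v ∘ Sum.inr then
        if o ∘ Sum.inl = v ∘ Sum.inl then
          (1 / 2) ^ Fintype.card (MeasuredQubit J K) * walsh (s ∘ source) y *
            (walsh (s ∘ middle) w * walsh y w * walsh w (o ∘ Sum.inr) *
              gadgetAmplitude κ c (s ∘ source) (s ∘ axle) (s ∘ leaf) (o ∘ Sum.inl) w a b)
        else 0
      else 0).trans ?_)
  simp only [Finset.sum_ite_irrel, Finset.sum_const_zero, Fintype.sum_ite_eq', ← Finset.mul_sum,
    sum_gadgetAmplitude, mul_left_comm _ (gadgetScalar _ _ _ _ _)]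
  refine if_congr Iff.rfl ?_ rfl
  ring

theorem branch_phasePattern :
    (phasePattern κ c).branch s = branchScalar κ c s •
      (hadamardRight I J * phaseGate (walshSum κ c) * hadamardRight I J) := by
  ext out v
  set q := (s ∘ middle) ∆ (gadgetByproduct κ (s ∘ leaf) ∘ Sum.inr) with hq
  have hleft : (out ∆ Sum.elim (fun _ => false) q) ∘ Sum.inl = out ∘ Sum.inl := by
    funext i
    simp [Bool.symmDiff_eq_xor]
  have hright : (out ∆ Sum.elim (fun _ => false) q) ∘ Sum.inr = (out ∘ Sum.inr) ∆ q := rfl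
  rw [Matrix.smul_apply, hadamardRight_mul_phaseGate_mul_hadamardRight_apply, Pattern.branch_apply,
    sum_measured_phasePattern, xCorrection_phasePattern, zCorrection_phasePattern, ← hq, hleft,
    hright, walsh_sum, hleft, hright, Sum.elim_comp_inl, Sum.elim_comp_inr, branchScalar, ← hq]
  by_cases hout : out ∘ Sum.inl = v ∘ Sum.inl
  · rw [if_pos hout, if_pos hout, hout, smul_eq_mul]
    have hpow : (2 : ℂ) ^ Fintype.card J * (1 / 2) ^ Fintype.card J = 1 := by
      rw [← mul_pow, mul_one_div_cancel two_ne_zero, one_pow]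
    have hsum := sum_walsh_mul_walsh_sumElim (v ∘ Sum.inl) (s ∘ source) (v ∘ Sum.inr)
      (out ∘ Sum.inr) (s ∘ middle) (gadgetByproduct κ (s ∘ leaf)) fun w =>
        Complex.exp (Complex.I * walshSum κ c (Sum.elim (v ∘ Sum.inl) w))
    rw [← hq] at hsum
    rw [mul_left_comm, hsum]
    linear_combination (-((1 / 2) ^ Fintype.card (MeasuredQubit J K) *
      gadgetScalar κ c (s ∘ source) (s ∘ axle) (s ∘ leaf) * (walsh (s ∘ source) q *
        ∑ w, walsh w (v ∘ Sum.inr) * walsh w (out ∘ Sum.inr) *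
          Complex.exp (Complex.I * walshSum κ c (Sum.elim (v ∘ Sum.inl) w))))) * hpow
  · rw [if_neg hout, if_neg hout, mul_zero, smul_zero]

theorem phasePattern_implements : (phasePattern κ c).Implements
    (hadamardRight I J * phaseGate (walshSum κ c) * hadamardRight I J) :=
  (phasePattern κ c).implements_of_branch (branchScalar κ c) (fun s => branch_phasePattern κ c s)
    (sum_norm_branchScalar_sq κ c)

theorem exists_pattern_depth_le_three_implements (g : Bits (I ⊕ J) → ℝ) :
    ∃ P : Pattern (I ⊕ J) (I ⊕ J), P.depth ≤ 3 ∧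
      P.Implements (hadamardRight I J * phaseGate g * hadamardRight I J) := by
  refine ⟨phasePattern id (walshCoeff g), depth_phasePattern_le _ _, ?_⟩
  simpa only [walshSum_walshCoeff] using phasePattern_implements id (walshCoeff g)

end PhasePattern

section Oracle

variable {n m : ℕ} (f : Bits (Fin n) → Bits (Fin m))

/-- The phase `π (w · f(x))` at the bit string `(x, w)`; conjugated by Hadamard gates on the second
register, it gives the oracle of `f`. -/
def oraclePhase (z : Bits (Fin n ⊕ Fin m)) : ℝ :=
  ∑ j, if z (Sum.inr j) && f (z ∘ Sum.inl) j then Real.pi else 0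

theorem exp_I_mul_oraclePhase (x : Bits (Fin n)) (w : Bits (Fin m)) :
    Complex.exp (Complex.I * oraclePhase f (Sum.elim x w)) = walsh w (f x) := by
  have hbit (b : Bool) :
      Complex.exp (Complex.I * (if b then Real.pi else 0 : ℝ)) = bitSign b := by
    cases b <;> simp [mul_comm Complex.I, Complex.exp_pi_mul_I]
  simp only [oraclePhase, Complex.ofReal_sum, Finset.mul_sum, Complex.exp_sum, walsh]
  exact Finset.prod_congr rfl fun j _ => hbit _

theorem eq_oracleMap_iff (z v : Bits (Fin n ⊕ Fin m)) :
    z = oracleMap f v ↔ z ∘ Sum.inl = v ∘ Sum.inl ∧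
      z ∘ Sum.inr = (v ∘ Sum.inr) ∆ f (v ∘ Sum.inl) := by
  have hmap : oracleMap f v =
      Sum.elim (v ∘ Sum.inl) ((v ∘ Sum.inr) ∆ f (v ∘ Sum.inl)) := by
    simp only [oracleMap, Function.comp_def, Pi.symmDiff_def, Bool.symmDiff_eq_xor]
  rw [hmap, ← Sum.elim_eq_iff, Sum.elim_comp_inl_inr]

theorem hadamardRight_mul_phaseGate_oraclePhase_mul_hadamardRight :
    hadamardRight (Fin n) (Fin m) * phaseGate (oraclePhase f) * hadamardRight (Fin n) (Fin m) =
      oracle f := by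
  ext z v
  have hsum : ∑ w, walsh w (v ∘ Sum.inr) * walsh w (z ∘ Sum.inr) * walsh w (f (v ∘ Sum.inl)) =
      if z ∘ Sum.inr = (v ∘ Sum.inr) ∆ f (v ∘ Sum.inl) then (2 : ℂ) ^ Fintype.card (Fin m)
      else 0 := by
    rw [← sum_walsh_mul_walsh]
    refine Finset.sum_congr rfl fun w _ => ?_
    rw [walsh_symmDiff]
    ring
  rw [hadamardRight_mul_phaseGate_mul_hadamardRight_apply]
  simp only [exp_I_mul_oraclePhase, hsum, oracle, Matrix.of_apply, eq_oracleMap_iff, ite_and,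
    mul_ite, mul_zero, ← mul_pow, one_div_mul_cancel (two_ne_zero (α := ℂ)), one_pow]

end Oracle

end MBQC

end

theorem mainTheorem1 :
    ∃ d : ℕ, ∀ (n m : ℕ) (f : MBQC.Bits (Fin n) → MBQC.Bits (Fin m)),
      ∃ P : MBQC.Pattern (Fin n ⊕ Fin m) (Fin n ⊕ Fin m),
        P.depth ≤ (d : ℕ∞) ∧ P.Implements (MBQC.oracle f) :=
  ⟨3, fun _ _ f => MBQC.hadamardRight_mul_phaseGate_oraclePhase_mul_hadamardRight f ▸
    MBQC.exists_pattern_depth_le_three_implements (MBQC.oraclePhase f)⟩
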